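/- All graphs are finite and simple; eigenvalues, eigenvectors and eigenspaces of a graph are those of its real adjacency matrix, and an eigenvector is nonzero by definition. For a graph $G$ and $\lambda\in\mathbb R$ let $N_\lambda(G)$ be the set of vertices on which every eigenvector of $G$ for $\lambda$ vanishes, and let $G\setminus M$ denote the graph obtained from $G$ by deleting the vertices in $M$ together with all incident edges. Let $\mathcal C$ be the class of trees that have an eigenvector for eigenvalue $1$ with all entries in $\{1,-1\}$, and let $\mathcal C_{-}$ be the class of trees that have an eigenvector for eigenvalue $-1$ with all entries in $\{1,-1\}$. Theorem. Let $T$ be a tree. (a) If $1$ is an eigenvalue of $T$, then the eigenspace of $T$ for eigenvalue $1$ has a basis consisting of vectors with entries in $\{0,1,-1\}$ if and only if every connected component of $T\setminus N_1(T)$ belongs to $\mathcal C$. (b) If $-1$ is an eigenvalue of $T$, then the following are equivalent: the eigenspace of $T$ for eigenvalue $-1$ has a basis consisting of vectors with entries in $\{0,1,-1\}$; every connected component of $T\setminus N_1(T)$ belongs to $\mathcal C$; every connected component of $T\setminus N_{-1}(T)$ belongs to $\mathcal C_{-}$. -/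

import Mathlib

namespace TreeEigen

universe u

/-- The adjacency matrix of a finite simple graph, as an endomorphism of `ℝ^V`. -/
noncomputable def adjEnd {V : Type u} [Finite V] (G : SimpleGraph V) : Module.End ℝ (V → ℝ) :=
  letI := Fintype.ofFinite V
  letI := Classical.decRel G.Adj
  (G.adjMatrix ℝ).mulVecLin

/-- The eigenspace of a graph for `μ` (`⊥` if `μ` is not an eigenvalue). -/
noncomputable def eigsp {V : Type u} [Finite V] (G : SimpleGraph V) (μ : ℝ) :
    Submodule ℝ (V → ℝ) :=
  Module.End.eigenspace (adjEnd G) μ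

/-- `N_μ(G)`: the vertices on which every eigenvector of `G` for `μ` vanishes. -/
def alwaysZero {V : Type u} [Finite V] (G : SimpleGraph V) (μ : ℝ) : Set V :=
  {v | ∀ x : V → ℝ, Module.End.HasEigenvector (adjEnd G) μ x → x v = 0}

/-- `G ∖ M`: remove the vertices of `M` and all edges incident with them. -/
abbrev removeVerts {V : Type u} (G : SimpleGraph V) (M : Set V) : SimpleGraph ↥(Mᶜ) :=
  G.induce Mᶜ

/-- The eigenspace of `G` for `μ` has a basis all of whose vectors have entries in `{0, 1, -1}`. -/
def HasSimplyStructuredBasis {V : Type u} [Finite V] (G : SimpleGraph V) (μ : ℝ) : Prop :=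
  ∃ b : Module.Basis (Fin (Module.finrank ℝ (eigsp G μ))) ℝ (eigsp G μ),
    ∀ i v, (b i : V → ℝ) v ∈ ({0, 1, -1} : Set ℝ)

/-- Trees with an eigenvector for `μ` all of whose entries lie in `{1, -1}`;
the class `𝒞` is the case `μ = 1`. -/
def InSignClass {V : Type u} [Finite V] (G : SimpleGraph V) (μ : ℝ) : Prop :=
  G.IsTree ∧ ∃ x : V → ℝ, Module.End.HasEigenvector (adjEnd G) μ x ∧
    ∀ v, x v ∈ ({1, -1} : Set ℝ)

/-- The class `𝒞` of all trees with a `{1, -1}` eigenvector for eigenvalue `1`. -/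
def InClassC {V : Type u} [Finite V] (G : SimpleGraph V) : Prop :=
  InSignClass G 1

end TreeEigen

namespace TreeEigen

open SimpleGraph

/-! ### Eigenvectors as solutions of local equations -/

section Basic

/-! For eigenvectors `x`, `y` of a forest for the same `μ`, the discrete Wronskian `x u * y v - x v
* y u` on edges is a circulation, so it vanishes (`mul_eq_mul_of_adj`). Hence a vector of a `{0, 1,
-1}` basis that is nonzero at one vertex of a component of `G ∖ N_μ` is nonzero on all of it, and
its restriction there is a sign eigenvector.

Conversely, sign eigenvectors on the components force every eigenvector to have constant modulus on
each component. Induction on the support (`mem_span_simpleVectors`) then splits it into multiples of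
`{0, 1, -1}` eigenvectors. All this works for any real `μ`; bipartiteness exchanges `1` and `-1`. -/

lemma sum_repr_mul_apply {V ι : Type*} [Fintype ι] {S : Submodule ℝ (V → ℝ)}
    (b : Module.Basis ι ℝ S) (z : S) (v : V) :
    ∑ i, b.repr z i * (b i : V → ℝ) v = (z : V → ℝ) v := by
  conv_rhs => rw [← b.sum_repr z]
  simp only [Submodule.coe_sum, Submodule.coe_smul, Finset.sum_apply, Pi.smul_apply, smul_eq_mul]

variable {V : Type*} [Finite V] {G : SimpleGraph V} {μ : ℝ} {x : V → ℝ}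

open Classical in
lemma mem_eigsp_iff [Fintype V] :
    x ∈ eigsp G μ ↔ ∀ v, ∑ u, (if G.Adj v u then x u else 0) = μ * x v := by
  have hF : Fintype.ofFinite V = ‹Fintype V› := Subsingleton.elim _ _
  rw [eigsp, Module.End.mem_eigenspace_iff, funext_iff]
  refine forall_congr' fun v => ?_
  simp only [adjEnd, Matrix.mulVecLin_apply, Matrix.mulVec, dotProduct, adjMatrix_apply,
    ite_mul, one_mul, zero_mul, Pi.smul_apply, smul_eq_mul]
  rw [hF]

lemma notMem_alwaysZero_iff {v : V} :
    v ∉ alwaysZero G μ ↔ ∃ x ∈ eigsp G μ, x v ≠ 0 := by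
  simp only [alwaysZero, Set.mem_ofPred_eq, not_forall, exists_prop]
  constructor
  · rintro ⟨x, hx, hv⟩
    exact ⟨x, hx.1, hv⟩
  · rintro ⟨x, hx, hv⟩
    exact ⟨x, ⟨hx, fun h => hv (by simp [h])⟩, hv⟩

lemma eq_zero_of_mem_alwaysZero {v : V} (hv : v ∈ alwaysZero G μ) (hx : x ∈ eigsp G μ) :
    x v = 0 := by
  by_contra h
  exact notMem_alwaysZero_iff.2 ⟨x, hx, h⟩ hv

/-- An eigenvector that vanishes on the outer boundary of an induced subgraph restricts to it. -/
lemma comp_embedding_mem_eigsp {W : Type*} [Finite W] {H : SimpleGraph W} (f : H ↪g G)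
    (hx : x ∈ eigsp G μ) (h0 : ∀ a v, G.Adj (f a) v → v ∉ Set.range f → x v = 0) :
    x ∘ f ∈ eigsp H μ := by
  classical
  cases nonempty_fintype V
  cases nonempty_fintype W
  rw [mem_eigsp_iff] at hx ⊢
  intro a
  rw [Function.comp_apply, ← hx (f a)]
  refine Fintype.sum_of_injective f f.injective _ _ (fun v hv => ?_) (fun b => ?_)
  · split_ifs with hadj
    · exact h0 a v hadj hv
    · rfl
  · simp

end Basic

/-! ### Cutting forests at an edge -/

section Forest

variable {V : Type*} {G : SimpleGraph V}

/-- The part of `G` on the side of `u` after the edge `uv` is removed. -/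
def branch (G : SimpleGraph V) (u v : V) : Set V :=
  {w | (G.deleteEdges {s(u, v)}).Reachable u w}

lemma self_mem_branch (u v : V) : u ∈ branch G u v := Reachable.refl _

lemma notMem_branch (hG : G.IsAcyclic) {u v : V} (h : G.Adj u v) : v ∉ branch G u v :=
  isBridge_iff.1 (isAcyclic_iff_forall_adj_isBridge.1 hG h)

/-- The only edge that leaves a branch of a forest is the one that was cut. -/
lemma eq_of_adj_of_mem_branch (hG : G.IsAcyclic) {u v w z : V} (h : G.Adj u v)
    (hw : w ∈ branch G u v) (hz : z ∉ branch G u v) (hwz : G.Adj w z) : w = u ∧ z = v := by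
  by_cases he : s(w, z) = s(u, v)
  · rcases Sym2.eq_iff.1 he with h' | ⟨rfl, rfl⟩
    · exact h'
    · exact absurd hw (notMem_branch hG h)
  · refine absurd (Reachable.trans hw (Adj.reachable ?_)) hz
    rw [deleteEdges_adj]
    exact ⟨hwz, by simpa using he⟩

lemma notMem_branch_of_adj (hG : G.IsAcyclic) {u v w : V} (h : G.Adj u v) (hw : G.Adj w v)
    (hne : w ≠ u) : w ∉ branch G u v := fun hmem =>
  hne (eq_of_adj_of_mem_branch hG h hmem (notMem_branch hG h) hw).1

/-- A circulation on a forest vanishes. -/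
lemma circulation_eq_zero [Fintype V] (hG : G.IsAcyclic) (f : V → V → ℝ)
    (hsupp : ∀ u v, ¬ G.Adj u v → f u v = 0) (hanti : ∀ u v, f u v = - f v u)
    (hdiv : ∀ u, ∑ v, f u v = 0) (u v : V) : f u v = 0 := by
  classical
  by_cases h : G.Adj u v
  swap
  · exact hsupp u v h
  set S : Finset V := Finset.univ.filter (· ∈ branch G u v) with hS
  have hmem : ∀ w, w ∈ S ↔ w ∈ branch G u v := by simp [hS]
  -- By antisymmetry the flow inside the branch cancels, so the total divergence over the branch is
  -- the flow through the cut edge.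
  have hin : ∑ w ∈ S, ∑ z ∈ S, f w z = 0 := by
    have h1 : ∑ w ∈ S, ∑ z ∈ S, f w z = - ∑ w ∈ S, ∑ z ∈ S, f w z := by
      conv_lhs => rw [Finset.sum_comm]
      rw [← Finset.sum_neg_distrib]
      refine Finset.sum_congr rfl fun w _ => ?_
      rw [← Finset.sum_neg_distrib]
      exact Finset.sum_congr rfl fun z _ => hanti z w
    linarith
  have hout : ∑ w ∈ S, ∑ z ∈ Sᶜ, f w z = f u v := by
    rw [Finset.sum_eq_single_of_mem u ((hmem u).2 (self_mem_branch u v)),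
      Finset.sum_eq_single_of_mem v]
    · simpa [hmem] using notMem_branch hG h
    · intro z hz hzv
      by_contra hne
      refine hzv (eq_of_adj_of_mem_branch hG h (self_mem_branch u v) ?_ ?_).2
      · simpa [hmem] using hz
      · exact by_contra fun hn => hne (hsupp _ _ hn)
    · intro w hw hwu
      refine Finset.sum_eq_zero fun z hz => ?_
      by_contra hne
      refine hwu (eq_of_adj_of_mem_branch hG h ((hmem w).1 hw) (z := z) ?_ ?_).1
      · simpa [hmem] using hz
      · exact by_contra fun hn => hne (hsupp _ _ hn)
  have htot : ∑ w ∈ S, (∑ z ∈ S, f w z + ∑ z ∈ Sᶜ, f w z) = 0 :=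
    Finset.sum_eq_zero fun w _ => by rw [Finset.sum_add_sum_compl, hdiv]
  rw [Finset.sum_add_distrib, hin, hout, zero_add] at htot
  exact htot

/-! ### Eigenvectors of forests -/

variable [Finite V] {μ : ℝ} {x y : V → ℝ}

/-- Two eigenvectors of a forest for the same eigenvalue are proportional along every edge. -/
lemma mul_eq_mul_of_adj (hG : G.IsAcyclic) (hx : x ∈ eigsp G μ) (hy : y ∈ eigsp G μ) {u v : V}
    (h : G.Adj u v) : x u * y v = x v * y u := by
  classical
  cases nonempty_fintype V
  rw [mem_eigsp_iff] at hx hy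
  have := circulation_eq_zero hG (fun u v => if G.Adj u v then x u * y v - x v * y u else 0)
    (fun u v h => if_neg h) (fun u v => by simp only [G.adj_comm u v]; split_ifs <;> ring)
    (fun w => ?_) u v
  · simp only [h, if_true] at this
    linarith
  · calc _ = x w * ∑ z, (if G.Adj w z then y z else 0)
          - y w * ∑ z, (if G.Adj w z then x z else 0) := by
          rw [Finset.mul_sum, Finset.mul_sum, ← Finset.sum_sub_distrib]
          exact Finset.sum_congr rfl fun z _ => by split_ifs <;> ring
      _ = 0 := by rw [hx, hy]; ring

lemma ne_zero_of_adj (hG : G.IsAcyclic) (hx : x ∈ eigsp G μ) {u v : V} (h : G.Adj u v)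
    (hv : v ∉ alwaysZero G μ) (hxu : x u ≠ 0) : x v ≠ 0 := by
  obtain ⟨y, hy, hyv⟩ := notMem_alwaysZero_iff.1 hv
  have := mul_eq_mul_of_adj hG hx hy h
  intro h0
  rw [h0, zero_mul] at this
  exact mul_ne_zero hxu hyv this

open Classical in
/-- Cutting an eigenvector at an edge `uv` with `x v = 0` spoils the equation only at `v`. -/
lemma sum_indicator_branch [Fintype V] (hG : G.IsAcyclic) (hx : x ∈ eigsp G μ) {u v : V}
    (h : G.Adj u v) (hv : x v = 0) (w : V) :
    ∑ z, (if G.Adj w z then (branch G u v).indicator x z else 0) =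
      μ * (branch G u v).indicator x w + if w = v then x u else 0 := by
  rw [mem_eigsp_iff] at hx
  by_cases hw : w ∈ branch G u v
  · have hwv : w ≠ v := fun e => notMem_branch hG h (e ▸ hw)
    rw [Set.indicator_of_mem hw, if_neg hwv, add_zero, ← hx w]
    refine Finset.sum_congr rfl fun z _ => ?_
    split_ifs with hwz
    · by_cases hz : z ∈ branch G u v
      · rw [Set.indicator_of_mem hz]
      · rw [Set.indicator_of_notMem hz, (eq_of_adj_of_mem_branch hG h hw hz hwz).2, hv]
    · rfl
  · rw [Set.indicator_of_notMem hw, mul_zero, zero_add]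
    split_ifs with hwv
    · subst hwv
      rw [Finset.sum_eq_single u]
      · rw [if_pos h.symm, Set.indicator_of_mem (self_mem_branch u w)]
      · intro z _ hzu
        split_ifs with hwz
        · refine Set.indicator_of_notMem (fun hz => hzu ?_) _
          exact (eq_of_adj_of_mem_branch hG h hz hw hwz.symm).1
        · rfl
      · simp
    · refine Finset.sum_eq_zero fun z _ => ?_
      split_ifs with hwz
      · refine Set.indicator_of_notMem (fun hz => hwv ?_) _
        exact (eq_of_adj_of_mem_branch hG h hz hw hwz.symm).2
      · rfl

/-- Two branches at a common zero `v` combine to an eigenvector. -/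
lemma branch_combination_mem_eigsp (hG : G.IsAcyclic) (hx : x ∈ eigsp G μ) {u u' v : V}
    (h : G.Adj u v) (h' : G.Adj u' v) (hv : x v = 0) :
    x u' • (branch G u v).indicator x - x u • (branch G u' v).indicator x ∈ eigsp G μ := by
  classical
  cases nonempty_fintype V
  have e := sum_indicator_branch hG hx h hv
  have e' := sum_indicator_branch hG hx h' hv
  rw [mem_eigsp_iff]
  intro w
  calc _ = x u' * ∑ z, (if G.Adj w z then (branch G u v).indicator x z else 0)
        - x u * ∑ z, (if G.Adj w z then (branch G u' v).indicator x z else 0) := by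
        rw [Finset.mul_sum, Finset.mul_sum, ← Finset.sum_sub_distrib]
        refine Finset.sum_congr rfl fun z _ => ?_
        split_ifs <;> simp
    _ = _ := by
        rw [e, e']
        simp only [Pi.sub_apply, Pi.smul_apply, smul_eq_mul]
        split_ifs <;> ring

/-- If the entries of an eigenvector agree in modulus across edges and around its forced zeros,
then its restriction to a level set of the modulus is an eigenvector. -/
lemma levelSet_mem_eigsp (hx : x ∈ eigsp G μ)
    (hedge : ∀ u v, G.Adj u v → u ∉ alwaysZero G μ → v ∉ alwaysZero G μ → |x u| = |x v|)
    (hstar : ∀ v ∈ alwaysZero G μ, ∀ u u', G.Adj u v → G.Adj u' v → x u ≠ 0 → x u' ≠ 0 →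
      |x u| = |x u'|) {a : ℝ} (ha : a ≠ 0) :
    {w | |x w| = a}.indicator x ∈ eigsp G μ := by
  classical
  cases nonempty_fintype V
  have hx' := hx
  rw [mem_eigsp_iff] at hx ⊢
  have hmem : ∀ w, |x w| = a → w ∉ alwaysZero G μ := fun w hw hN =>
    ha (by rw [← hw, eq_zero_of_mem_alwaysZero hN hx', abs_zero])
  have hmem' : ∀ w, x w ≠ 0 → w ∉ alwaysZero G μ := fun w hw hN =>
    hw (eq_zero_of_mem_alwaysZero hN hx')
  -- At each vertex, either all nonzero neighbours lie in the level set and the sum is unchanged, or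
  -- none does and the sum is zero.
  have keep : ∀ v, (∀ z, G.Adj v z → x z ≠ 0 → |x z| = a) →
      ∑ u, (if G.Adj v u then {w | |x w| = a}.indicator x u else 0) = μ * x v := by
    intro v hall
    rw [← hx v]
    refine Finset.sum_congr rfl fun z _ => ?_
    split_ifs with hvz
    · by_cases hz : x z = 0
      · simp [Set.indicator_apply, hz]
      · exact Set.indicator_of_mem (s := {w | |x w| = a}) (hall z hvz hz) _
    · rfl
  have kill : ∀ v, (∀ z, G.Adj v z → |x z| ≠ a) →
      ∑ u, (if G.Adj v u then {w | |x w| = a}.indicator x u else 0) = 0 := by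
    intro v hall
    refine Finset.sum_eq_zero fun z _ => ?_
    split_ifs with hvz
    · exact Set.indicator_of_notMem (s := {w | |x w| = a}) (hall z hvz) _
    · rfl
  intro v
  by_cases hN : v ∈ alwaysZero G μ
  · have hv0 := eq_zero_of_mem_alwaysZero hN hx'
    have : {w | |x w| = a}.indicator x v = 0 := by simp [Set.indicator_apply, hv0]
    rw [this, mul_zero]
    by_cases hex : ∃ u, G.Adj v u ∧ |x u| = a
    · obtain ⟨u, hvu, hu⟩ := hex
      have hu0 : x u ≠ 0 := fun h0 => ha (by rw [← hu, h0, abs_zero])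
      rw [keep v fun z hvz hz => (hstar v hN z u hvz.symm hvu.symm hz hu0).trans hu, hv0, mul_zero]
    · exact kill v fun z hvz hz => hex ⟨z, hvz, hz⟩
  · by_cases hva : |x v| = a
    · rw [Set.indicator_of_mem (s := {w | |x w| = a}) hva]
      exact keep v fun z hvz hz => (hedge v z hvz hN (hmem' z hz)).symm.trans hva
    · rw [Set.indicator_of_notMem (s := {w | |x w| = a}) hva, mul_zero]
      exact kill v fun z hvz hz => hva ((hedge v z hvz hN (hmem z hz)).trans hz)

/-- The eigenvectors (and zero) with all entries in `{0, 1, -1}`. -/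
def simpleVectors (G : SimpleGraph V) (μ : ℝ) : Set (V → ℝ) :=
  {y | y ∈ eigsp G μ ∧ ∀ v, y v ∈ ({0, 1, -1} : Set ℝ)}

-- Strong induction on the size of the support. If the moduli agree around each forced zero, a level
-- set splits off. Otherwise two branches at a bad forced zero combine to an eigenvector of smaller
-- support, and subtracting a multiple of it shrinks the support of `x` too.
open Function in
lemma mem_span_simpleVectors (hG : G.IsAcyclic)
    (hedge : ∀ x ∈ eigsp G μ, ∀ u v, G.Adj u v → u ∉ alwaysZero G μ → v ∉ alwaysZero G μ →
      |x u| = |x v|) (hx : x ∈ eigsp G μ) : x ∈ Submodule.span ℝ (simpleVectors G μ) := by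
  classical
  induction hn : (support x).ncard using Nat.strong_induction_on generalizing x with
  | _ n ih =>
  have smaller : ∀ y ∈ eigsp G μ, (∀ w, x w = 0 → y w = 0) → (∃ w, y w = 0 ∧ x w ≠ 0) →
      y ∈ Submodule.span ℝ (simpleVectors G μ) := by
    rintro y hy hsub ⟨w, hyw, hxw⟩
    refine ih _ ?_ hy rfl
    rw [← hn]
    refine Set.ncard_lt_ncard ⟨fun w => mt (hsub w), fun hle => hle hxw hyw⟩ (Set.toFinite _)
  by_cases hstar : ∀ v ∈ alwaysZero G μ, ∀ u u', G.Adj u v → G.Adj u' v → x u ≠ 0 → x u' ≠ 0 →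
      |x u| = |x u'|
  · by_cases hzero : ∃ r, x r ≠ 0
    swap
    · push Not at hzero
      rw [show x = 0 from funext hzero]
      exact zero_mem _
    obtain ⟨r, hr⟩ := hzero
    have ha : |x r| ≠ 0 := abs_ne_zero.2 hr
    have hlev := levelSet_mem_eigsp hx (hedge x hx) hstar ha
    set l := {w | |x w| = |x r|}.indicator x with hl
    have hlr : l r = x r := Set.indicator_of_mem (s := {w | |x w| = |x r|}) rfl _
    have hsimple : |x r|⁻¹ • l ∈ simpleVectors G μ := by
      refine ⟨Submodule.smul_mem _ _ hlev, fun v => ?_⟩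
      by_cases hv : |x v| = |x r|
      · have : l v = x v := Set.indicator_of_mem (s := {w | |x w| = |x r|}) hv _
        rw [Pi.smul_apply, this, smul_eq_mul, ← hv]
        have hv0 : x v ≠ 0 := by
          rw [← abs_ne_zero, hv]; exact ha
        rcases abs_choice (x v) with h | h <;> rw [h]
        · simp [inv_mul_cancel₀ hv0]
        · simp [inv_neg, inv_mul_cancel₀ hv0]
      · have : l v = 0 := Set.indicator_of_notMem (s := {w | |x w| = |x r|}) hv _
        simp [this]
    have hlspan : l ∈ Submodule.span ℝ (simpleVectors G μ) := by
      have := Submodule.smul_mem _ |x r| (Submodule.subset_span (R := ℝ) hsimple)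
      rwa [smul_smul, mul_inv_cancel₀ ha, one_smul] at this
    have hrest := smaller (x - l) (Submodule.sub_mem _ hx hlev)
      (fun w hw => by simp [hl, Set.indicator_apply, hw]) ⟨r, by simp [hlr], hr⟩
    simpa using Submodule.add_mem _ hrest hlspan
  · push Not at hstar
    obtain ⟨v, hv, u, u', hu, hu', hxu, hxu', hne⟩ := hstar
    have hv0 := eq_zero_of_mem_alwaysZero hv hx
    have huu' : u ≠ u' := fun e => hne (by rw [e])
    -- The neighbours of `v` sum to zero; if only `u` and `u'` contributed, their moduli would
    -- agree.
    have hthird : ∃ w, G.Adj w v ∧ w ≠ u ∧ w ≠ u' ∧ x w ≠ 0 := by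
      by_contra hcon
      push Not at hcon
      cases nonempty_fintype V
      have hsum := mem_eigsp_iff.1 hx v
      rw [hv0, mul_zero, Fintype.sum_eq_add u u' huu'
        (fun w hw => by
          split_ifs with hvw
          · exact hcon w hvw.symm hw.1 hw.2
          · rfl), if_pos hu.symm, if_pos hu'.symm] at hsum
      exact hne (by rw [eq_neg_of_add_eq_zero_left hsum, abs_neg])
    obtain ⟨w, hw, hwu, hwu', hxw⟩ := hthird
    have hcomb := branch_combination_mem_eigsp hG hx hu hu' hv0
    set y := x u' • (branch G u v).indicator x - x u • (branch G u' v).indicator x with hy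
    have hsub : ∀ w, x w = 0 → y w = 0 := fun w hw => by simp [hy, Set.indicator_apply, hw]
    have hyu : y u = x u' * x u := by
      simp [hy, Set.indicator_of_mem (self_mem_branch u v),
        Set.indicator_of_notMem (notMem_branch_of_adj hG hu' hu huu')]
    -- The third neighbour `w` lies in neither branch, so `y` vanishes there.
    have hyspan := smaller y hcomb hsub ⟨w, by
      simp [hy, Set.indicator_of_notMem (notMem_branch_of_adj hG hu hw hwu),
        Set.indicator_of_notMem (notMem_branch_of_adj hG hu' hw hwu')], hxw⟩
    -- The factor `(x u')⁻¹` makes the difference vanish at `u`.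
    have hrest := smaller (x - (x u')⁻¹ • y) (Submodule.sub_mem _ hx (Submodule.smul_mem _ _ hcomb))
      (fun w hw => by simp [hw, hsub w hw]) ⟨u, by simp [hyu, hxu'], hxu⟩
    simpa using Submodule.add_mem _ hrest (Submodule.smul_mem _ (x u')⁻¹ hyspan)

end Forest

/-! ### The criterion, and the passage between `μ` and `-μ` -/

section Main

variable {V : Type*} [Finite V] {G : SimpleGraph V} {μ : ℝ}

lemma hasSimplyStructuredBasis_of_span (h : eigsp G μ ≤ Submodule.span ℝ (simpleVectors G μ)) :
    HasSimplyStructuredBasis G μ := by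
  have hs : ⊤ ≤ Submodule.span ℝ ((eigsp G μ).subtype ⁻¹' simpleVectors G μ) := by
    rintro ⟨x, hx⟩ -
    have hx' := h hx
    rw [← Set.image_preimage_eq_of_subset (f := (eigsp G μ).subtype) (s := simpleVectors G μ)
      fun y hy => ⟨⟨y, hy.1⟩, rfl⟩, ← Submodule.map_span] at hx'
    obtain ⟨x', hmem, rfl⟩ := hx'
    exact hmem
  let b := Module.Basis.ofSpan hs
  have hb : ∀ i, (b i : V → ℝ) ∈ simpleVectors G μ := fun i =>
    Module.Basis.ofSpan_subset hs ⟨i, rfl⟩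
  exact ⟨b.reindex (b.indexEquiv (Module.finBasis ℝ (eigsp G μ))), fun i v => by
    rw [Module.Basis.reindex_apply]
    exact (hb _).2 v⟩

/-- The inclusion of a component of `G ∖ M` into `G`. -/
def componentEmbedding {M : Set V} (C : (removeVerts G M).ConnectedComponent) :
    C.toSimpleGraph ↪g G where
  toFun a := a.1.1
  inj' _ _ h := Subtype.ext (Subtype.ext h)
  map_rel_iff' := Iff.rfl

/-- Every neighbour of the component outside it is a forced zero, so it contributes nothing. -/
lemma comp_componentEmbedding_mem_eigsp
    (C : (removeVerts G (alwaysZero G μ)).ConnectedComponent) {x : V → ℝ} (hx : x ∈ eigsp G μ) :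
    x ∘ componentEmbedding C ∈ eigsp C.toSimpleGraph μ := by
  refine comp_embedding_mem_eigsp _ hx fun a v hav hv => ?_
  by_contra h0
  have hvN : v ∉ alwaysZero G μ := notMem_alwaysZero_iff.2 ⟨x, hx, h0⟩
  refine hv ⟨⟨⟨v, hvN⟩, ?_⟩, rfl⟩
  exact C.mem_supp_of_adj_mem_supp a.2 (show (removeVerts G _).Adj a.1 ⟨v, hvN⟩ from hav)

/-- If `μ` is not an eigenvalue, no vertex survives the deletion and both sides hold trivially. -/
theorem hasSimplyStructuredBasis_iff (hG : G.IsAcyclic) :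
    HasSimplyStructuredBasis G μ ↔
      ∀ C : (removeVerts G (alwaysZero G μ)).ConnectedComponent,
        InSignClass C.toSimpleGraph μ := by
  constructor
  · rintro ⟨b, hb⟩ C
    refine ⟨(hG.induce _).isTree_connectedComponent C, ?_⟩
    obtain ⟨r⟩ := C.connected_toSimpleGraph.nonempty
    obtain ⟨y, hy, hyr⟩ := notMem_alwaysZero_iff.1 r.1.2
    obtain ⟨i, hi⟩ : ∃ i, (b i : V → ℝ) r.1.1 ≠ 0 := by
      by_contra hcon
      push Not at hcon
      have hrepr := sum_repr_mul_apply b ⟨y, hy⟩ r.1.1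
      simp only [hcon, mul_zero, Finset.sum_const_zero] at hrepr
      exact hyr hrepr.symm
    have hwalk : ∀ r a, C.toSimpleGraph.Walk r a → (b i : V → ℝ) r.1.1 ≠ 0 →
        (b i : V → ℝ) a.1.1 ≠ 0 := by
      intro r a p
      induction p with
      | nil => exact id
      | @cons _ w _ hadj _ ih => exact fun h => ih (ne_zero_of_adj hG (b i).2 hadj w.1.2 h)
    have hne : ∀ a, ((b i : V → ℝ) ∘ componentEmbedding C) a ≠ 0 := fun a =>
      hwalk r a (C.connected_toSimpleGraph.preconnected r a).some hi
    refine ⟨(b i : V → ℝ) ∘ componentEmbedding C,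
      ⟨comp_componentEmbedding_mem_eigsp C (b i).2, fun h => hne r (congrFun h r)⟩, fun a => ?_⟩
    exact (hb i _).resolve_left (hne a)
  · intro h
    refine hasSimplyStructuredBasis_of_span fun x hx => mem_span_simpleVectors hG ?_ hx
    intro x hx u v huv hu hv
    let C := (removeVerts G (alwaysZero G μ)).connectedComponentMk ⟨u, hu⟩
    obtain ⟨hC, z, hz, hz1⟩ := h C
    have hadj : (removeVerts G (alwaysZero G μ)).Adj ⟨u, hu⟩ ⟨v, hv⟩ := huv
    have huC : ⟨u, hu⟩ ∈ C.supp := ConnectedComponent.connectedComponentMk_mem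
    have hvC : ⟨v, hv⟩ ∈ C.supp := C.mem_supp_of_adj_mem_supp huC hadj
    have hadjC : C.toSimpleGraph.Adj ⟨⟨u, hu⟩, huC⟩ ⟨⟨v, hv⟩, hvC⟩ := hadj
    have hprop := mul_eq_mul_of_adj hC.isAcyclic (comp_componentEmbedding_mem_eigsp C hx) hz.1
      hadjC
    have habs : ∀ a, |z a| = 1 := fun a => by
      rcases hz1 a with h | h <;> rw [h] <;> simp
    have := congrArg abs hprop
    rwa [abs_mul, abs_mul, habs, habs, mul_one, mul_one] at this

/-- In a bipartite graph, changing signs on one side carries eigenvectors for `μ` to `-μ`. -/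
lemma signFlip_mem_eigsp (c : G.Coloring (Fin 2)) {x : V → ℝ} (hx : x ∈ eigsp G μ) :
    (fun v => (if c v = 0 then 1 else -1) * x v) ∈ eigsp G (-μ) := by
  classical
  cases nonempty_fintype V
  rw [mem_eigsp_iff] at hx ⊢
  intro v
  calc _ = -(if c v = 0 then 1 else -1) * ∑ u, (if G.Adj v u then x u else 0) := by
        rw [Finset.mul_sum]
        refine Finset.sum_congr rfl fun u _ => ?_
        by_cases h : G.Adj v u
        · have := c.valid h
          simp only [h, if_true]
          split_ifs <;> first | ring1 | omega
        · simp [h]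
    _ = _ := by rw [hx]; ring

lemma HasSimplyStructuredBasis.neg (hG : G.IsAcyclic) (h : HasSimplyStructuredBasis G μ) :
    HasSimplyStructuredBasis G (-μ) := by
  obtain ⟨c⟩ := hG.colorable_two
  obtain ⟨b, hb⟩ := h
  have hb' : ∀ i, (fun v => (if c v = 0 then 1 else -1) * (b i : V → ℝ) v) ∈
      simpleVectors G (-μ) := by
    refine fun i => ⟨signFlip_mem_eigsp c (b i).2, fun v => ?_⟩
    have hv := hb i v
    simp only [Set.mem_insert_iff, Set.mem_singleton_iff] at hv
    rcases hv with h | h | h <;> beta_reduce <;> rw [h] <;> split_ifs <;> simp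
  refine hasSimplyStructuredBasis_of_span fun x hx => ?_
  have hx' := signFlip_mem_eigsp c hx
  rw [neg_neg] at hx'
  -- Flipping signs twice is the identity, so expanding the flipped `x` in `b` expands `x` in the
  -- flipped basis.
  have : x = ∑ i, b.repr ⟨_, hx'⟩ i • fun v => (if c v = 0 then 1 else -1) * (b i : V → ℝ) v := by
    funext v
    have hv : _ = (if c v = 0 then 1 else -1) * x v := sum_repr_mul_apply b ⟨_, hx'⟩ v
    calc x v = (if c v = 0 then 1 else -1) * ((if c v = 0 then 1 else -1) * x v) := by
          split_ifs <;> ring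
      _ = _ := by
          rw [← hv, Finset.mul_sum, Finset.sum_apply]
          refine Finset.sum_congr rfl fun i _ => ?_
          rw [Pi.smul_apply, smul_eq_mul]
          ring
  rw [this]
  exact Submodule.sum_mem _ fun i _ => Submodule.smul_mem _ _ (Submodule.subset_span (hb' i))

end Main

end TreeEigen

theorem mainTheorem4 {V : Type*} [Finite V] (T : SimpleGraph V) (hT : T.IsTree) :
    (Module.End.HasEigenvalue (TreeEigen.adjEnd T) 1 →
      (TreeEigen.HasSimplyStructuredBasis T 1 ↔
        ∀ C : (TreeEigen.removeVerts T (TreeEigen.alwaysZero T 1)).ConnectedComponent,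
          TreeEigen.InClassC C.toSimpleGraph)) ∧
    (Module.End.HasEigenvalue (TreeEigen.adjEnd T) (-1) →
      (TreeEigen.HasSimplyStructuredBasis T (-1) ↔
        ∀ C : (TreeEigen.removeVerts T (TreeEigen.alwaysZero T 1)).ConnectedComponent,
          TreeEigen.InClassC C.toSimpleGraph) ∧
      (TreeEigen.HasSimplyStructuredBasis T (-1) ↔
        ∀ C : (TreeEigen.removeVerts T (TreeEigen.alwaysZero T (-1))).ConnectedComponent,
          TreeEigen.InSignClass C.toSimpleGraph (-1))) := by
  have hA := hT.isAcyclic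
  have hneg : TreeEigen.HasSimplyStructuredBasis T (-1) ↔
      TreeEigen.HasSimplyStructuredBasis T 1 :=
    ⟨fun h => by simpa using h.neg hA, fun h => h.neg hA⟩
  exact ⟨fun _ => TreeEigen.hasSimplyStructuredBasis_iff hA,
    fun _ => ⟨hneg.trans (TreeEigen.hasSimplyStructuredBasis_iff hA),
      TreeEigen.hasSimplyStructuredBasis_iff hA⟩⟩
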